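/- Let $n\ge 3$, and let $\|\cdot\|$ denote the norm of $L^2(\mathbb R^n;\mathbb C)$ or $L^2(\mathbb R^n;\mathbb C^n)$; all derivatives are distributional. Consider the dilation equality for $\varphi$, $$\|x\cdot\nabla\varphi\|^2=\Bigl\|x\cdot\nabla\varphi+\frac n2\varphi\Bigr\|^2+\Bigl(\frac n2\Bigr)^2\|\varphi\|^2,\qquad(\mathrm D_\varphi)$$ and the Hardy-type equality for $\psi$, $$\Bigl\|\frac{x}{|x|}\cdot\nabla\psi\Bigr\|^2=\Bigl\|\frac{x}{|x|}\cdot\nabla\psi+\frac{n-2}{2|x|}\psi\Bigr\|^2+\Bigl(\frac{n-2}{2}\Bigr)^2\Bigl\|\frac{\psi}{|x|}\Bigr\|^2.\qquad(\mathrm H_\psi)$$ 1. The following two assertions are equivalent: (i) $(\mathrm D_\varphi)$ holds for all $\varphi\in H^1(\mathbb R^n)$ with $x\cdot\nabla\varphi\in L^2(\mathbb R^n)$; (ii) for all $\psi\in H^1(\mathbb R^n)$, $\psi/|x|\in L^2(\mathbb R^n)$ and $(\mathrm H_\psi)$ holds. Moreover, both assertions are true. 2. The two equalities correspond to each other via $\varphi=\psi/|x|$.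 That is, for every $\psi\in H^1(\mathbb R^n)$ the function $\varphi=\psi/|x|$ lies in $L^2(\mathbb R^n)$, its distributional gradient is a locally integrable function, $x\cdot\nabla\varphi\in L^2(\mathbb R^n)$, $$\|x\cdot\nabla\varphi\|^2=\Bigl\|\frac{x}{|x|}\cdot\nabla\psi\Bigr\|^2+(n-1)\Bigl\|\frac{\psi}{|x|}\Bigr\|^2,\qquad x\cdot\nabla\varphi+\frac n2\varphi=\frac{x}{|x|}\cdot\nabla\psi+\frac{n-2}{2|x|}\psi\ \text{ almost everywhere},$$ and $(\mathrm D_\varphi)$ holds if and only if $(\mathrm H_\psi)$ holds. 3. Consequently, the Hardy inequality (uncertainty principle lemma) holds: for all $\psi\in H^1(\mathbb R^n)$, $$\Bigl\|\frac{\psi}{|x|}\Bigr\|\le\frac{2}{n-2}\Bigl\|\frac{x}{|x|}\cdot\nabla\psi\Bigr\|\le\frac{2}{n-2}\|\nabla\psi\|.$$ -/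

import Mathlib

open MeasureTheory
open scoped ContDiff

noncomputable section

/-- `ℝⁿ` with its Euclidean norm `|x|`. -/
abbrev Rn (n : ℕ) : Type := EuclideanSpace ℝ (Fin n)

/-- `ℂⁿ` with its Hermitian norm, the value space of gradients. -/
abbrev Cn (n : ℕ) : Type := EuclideanSpace ℂ (Fin n)

/-- The `L²(ℝⁿ)` norm of a scalar or vector valued function. -/
def l2 {n : ℕ} {F : Type*} [NormedAddCommGroup F] (f : Rn n → F) : ℝ :=
  lpNorm f 2 volume

/-- The locally integrable field `g` is the distributional gradient of the locally integrable
function `f`: `∫ f ∂ⱼθ = - ∫ gⱼ θ` for all `j` and all `θ ∈ C₀^∞(ℝⁿ)`. -/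
structure IsWeakGradient {n : ℕ} (f : Rn n → ℂ) (g : Rn n → Cn n) : Prop where
  locallyIntegrable : LocallyIntegrable f volume
  locallyIntegrable_grad : LocallyIntegrable g volume
  integral_eq : ∀ (j : Fin n) (θ : Rn n → ℝ), ContDiff ℝ ∞ θ → HasCompactSupport θ →
    ∫ x, (fderiv ℝ θ x (EuclideanSpace.single j 1)) • f x = - ∫ x, θ x • g x j

/-- `f ∈ H¹(ℝⁿ)`, with distributional gradient `g` (unique up to null sets). -/
structure InH1 {n : ℕ} (f : Rn n → ℂ) (g : Rn n → Cn n) : Prop where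
  memLp : MemLp f 2 volume
  isWeakGradient : IsWeakGradient f g
  memLp_grad : MemLp g 2 volume

/-- `x · g`; for `g = ∇φ` this is `x · ∇φ`. -/
def xDot {n : ℕ} (g : Rn n → Cn n) (x : Rn n) : ℂ :=
  ∑ j, ((x j : ℝ) : ℂ) * g x j

/-- `(x/|x|) · g`; for `g = ∇ψ` this is the radial derivative of `ψ`. -/
def radialDot {n : ℕ} (g : Rn n → Cn n) (x : Rn n) : ℂ :=
  ∑ j, ((x j / ‖x‖ : ℝ) : ℂ) * g x j

/-- `ψ/|x|`. -/
def divAbs {n : ℕ} (ψ : Rn n → ℂ) (x : Rn n) : ℂ := ψ x / (‖x‖ : ℂ)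

/-- `x · ∇φ + (n/2) φ`, where `h = ∇φ`. -/
def dilationRemainder {n : ℕ} (φ : Rn n → ℂ) (h : Rn n → Cn n) (x : Rn n) : ℂ :=
  xDot h x + ((n : ℂ) / 2) * φ x

/-- `(x/|x|) · ∇ψ + (n-2)/(2|x|) ψ`, where `g = ∇ψ`. -/
def hardyRemainder {n : ℕ} (ψ : Rn n → ℂ) (g : Rn n → Cn n) (x : Rn n) : ℂ :=
  radialDot g x + (((n : ℂ) - 2) / (2 * (‖x‖ : ℂ))) * ψ x

/-- `‖x·∇φ‖² = ‖x·∇φ + (n/2) φ‖² + (n/2)² ‖φ‖²`, where `h = ∇φ`. -/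
def DilationEquality {n : ℕ} (φ : Rn n → ℂ) (h : Rn n → Cn n) : Prop :=
  l2 (xDot h) ^ 2 = l2 (dilationRemainder φ h) ^ 2 + ((n : ℝ) / 2) ^ 2 * l2 φ ^ 2

/-- `‖(x/|x|)·∇ψ‖² = ‖(x/|x|)·∇ψ + (n-2)/(2|x|) ψ‖² + ((n-2)/2)² ‖ψ/|x|‖²`,
where `g = ∇ψ`. -/
def HardyEquality {n : ℕ} (ψ : Rn n → ℂ) (g : Rn n → Cn n) : Prop :=
  l2 (radialDot g) ^ 2 =
    l2 (hardyRemainder ψ g) ^ 2 + (((n : ℝ) - 2) / 2) ^ 2 * l2 (divAbs ψ) ^ 2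

/-- The dilation equality for all `φ ∈ H¹(ℝⁿ)` with `x · ∇φ ∈ L²(ℝⁿ)`. -/
def DilationEqualityHolds (n : ℕ) : Prop :=
  ∀ (φ : Rn n → ℂ) (h : Rn n → Cn n), InH1 φ h → MemLp (xDot h) 2 volume →
    DilationEquality φ h

/-- The Hardy type equality for all `ψ ∈ H¹(ℝⁿ)`, including that `ψ/|x| ∈ L²(ℝⁿ)`
(the other terms are then in `L²` as well). -/
def HardyEqualityHolds (n : ℕ) : Prop :=
  ∀ (ψ : Rn n → ℂ) (g : Rn n → Cn n), InH1 ψ g →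
    MemLp (divAbs ψ) 2 volume ∧ HardyEquality ψ g

end

open Filter Topology
open scoped Convolution ComplexConjugate

/-! Everything rests on one integration by parts. The field `w(x) x` has divergence `n w + x·∇w`,
and for `f ∈ H¹` the function `|f|²` has weak gradient `2 Re(f̄ ∇f)`, so `∫ (n w + x·∇w)|f|² = -∫ w
· 2 Re(f̄ x·∇f)` (`InH1.integral_norm_sq_mul_div`). For `w = 1` this evaluates the cross term in
`‖x·∇φ + (n/2)φ‖²`, which is the dilation equality. For `w = |x|⁻²` the divergence is `(n-2)|x|⁻²`,
and the same expansion of a square gives the Hardy equality; dropping the remainder gives the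
inequality.

The weight `|x|⁻²` is singular, so it is approached by `(|x|² + ε)⁻¹`. A crude bound uniform in `ε`
and Fatou's lemma give `ψ/|x| ∈ L²` (`InH1.memLp_divAbs`); only then does dominated convergence
yield the exact identity (`InH1.integral_conj_divAbs_mul_radialDot`).

For the correspondence, `∇(ψ/|x|) = ∇ψ/|x| - ψ x/|x|³` holds weakly across the origin
(`InH1.isWeakGradient_divAbs`), so `x·∇φ` is the radial derivative of `ψ` minus `ψ/|x|`. The two
equalities then match because `n - 1 = (n/2)² - ((n-2)/2)²`. As `ψ/|x|` need not lie in `H¹`,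
neither universal assertion is deduced from the other: each is proved directly. -/

/-! ### Mollification and the weak product rule for squares -/

/-- The `L²` pairing of `p` with the translates of `q` is continuous. -/
theorem continuous_integral_mul_translate {n : ℕ} {p q : Rn n → ℝ}
    (hp : MemLp p 2 volume) (hq : MemLp q 2 volume) :
    Continuous fun t : Rn n => ∫ x, p x * q (t + x) := by
  -- Translations act continuously on `L²`; this is where the finiteness of the exponent enters.
  have h1 : Continuous fun t : Rn n => (DomAddAct.mk t +ᵥ hq.toLp q : Lp ℝ 2 volume) := by
    have : Fact ((2 : ENNReal) ≠ ⊤) := ⟨by norm_num⟩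
    exact continuous_vadd.comp
      ((DomAddAct.mkHomeomorph.continuous).prodMk continuous_const)
  have h2 : Continuous fun t : Rn n =>
      inner ℝ (DomAddAct.mk t +ᵥ hq.toLp q : Lp ℝ 2 volume) (hp.toLp p) :=
    h1.inner continuous_const
  refine h2.congr fun t => ?_
  rw [DomAddAct.mk_vadd_toLp, L2.inner_def]
  refine integral_congr_ae ?_
  filter_upwards [MemLp.coeFn_toLp hp, MemLp.coeFn_toLp
    (hq.comp_measurePreserving (measurePreserving_add_left volume t))] with x h3 h4
  simp only [vadd_eq_add] at h4 ⊢
  rw [h3]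
  erw [h4]
  simp

/-- Since `2|p q| ≤ p² + q²`, the integrand is dominated by a product integrand for `p²`, `ρ` and a
convolution integrand for `ρ`, `q²`, both integrable. It justifies Fubini below. -/
theorem integrable_mul_convolution_integrand {n : ℕ} {p q : Rn n → ℝ}
    (hp : MemLp p 2 volume) (hq : MemLp q 2 volume) {ρ : Rn n → ℝ}
    (hρ : Continuous ρ) (hρc : HasCompactSupport ρ) :
    Integrable (fun z : Rn n × Rn n => p z.1 * (ρ z.2 * q (z.1 - z.2)))
      (volume.prod volume) := by
  have hρi : Integrable ρ := hρ.integrable_of_hasCompactSupport hρc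
  have hm : AEStronglyMeasurable (fun z : Rn n × Rn n => q (z.1 - z.2))
      (volume.prod volume) :=
    hq.aestronglyMeasurable.comp_quasiMeasurePreserving
      (quasiMeasurePreserving_sub volume volume)
  have i1 : Integrable (fun z : Rn n × Rn n => p z.1 ^ 2 * ρ z.2)
      (volume.prod volume) := hp.integrable_sq.mul_prod hρi
  have i2 : Integrable (fun z : Rn n × Rn n => ρ z.2 * q (z.1 - z.2) ^ 2)
      (volume.prod volume) :=
    hρi.convolution_integrand (ContinuousLinearMap.lsmul ℝ ℝ) hq.integrable_sq
  refine (i1.norm.add i2.norm).mono' ?_ (ae_of_all _ fun z => ?_)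
  · exact hp.aestronglyMeasurable.comp_fst.mul
      ((hρ.comp continuous_snd).aestronglyMeasurable.mul hm)
  · simp only [Pi.add_apply, Real.norm_eq_abs, abs_mul, abs_pow]
    nlinarith [sq_nonneg (|p z.1| - |q (z.1 - z.2)|), abs_nonneg (ρ z.2),
      mul_nonneg (abs_nonneg (ρ z.2)) (sq_nonneg (|p z.1| - |q (z.1 - z.2)|)),
      mul_nonneg (abs_nonneg (ρ z.2)) (sq_nonneg (|p z.1| )),
      mul_nonneg (abs_nonneg (ρ z.2)) (sq_nonneg (|q (z.1 - z.2)|))]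

/-- Mollifications of an `L²` function converge to it weakly in `L²`. -/
theorem tendsto_integral_mul_mollify {n : ℕ} {p q : Rn n → ℝ}
    (hp : MemLp p 2 volume) (hq : MemLp q 2 volume) {φ : ℕ → ContDiffBump (0 : Rn n)}
    (hφ : Tendsto (fun k => (φ k).rOut) atTop (𝓝 0)) :
    Tendsto (fun k => ∫ x, p x *
        ((φ k).normed volume ⋆[ContinuousLinearMap.lsmul ℝ ℝ, volume] q) x)
      atTop (𝓝 (∫ x, p x * q x)) := by
  -- By Fubini the mollified pairing is the bump average, at `0`, of the continuous function `t ↦ ∫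
  -- p(x) q(t + x)`.
  have h := ContDiffBump.convolution_tendsto_right_of_continuous (μ := (volume : Measure (Rn n)))
    hφ (continuous_integral_mul_translate hp hq) 0
  simp only [zero_add] at h
  refine h.congr fun k => ?_
  simp only [convolution_def, ContinuousLinearMap.lsmul_apply, smul_eq_mul, zero_sub]
  have := integral_integral_swap (μ := (volume : Measure (Rn n)))
    (ν := (volume : Measure (Rn n)))
    (f := fun x t => p x * ((φ k).normed volume t * q (x - t)))
    (integrable_mul_convolution_integrand hp hq
      (φ k).continuous_normed (φ k).hasCompactSupport_normed)
  simp only [integral_const_mul] at this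
  rw [this]
  refine integral_congr_ae (ae_of_all _ fun t => ?_)
  simp only
  rw [← integral_const_mul]
  refine integral_congr_ae (ae_of_all _ fun x => ?_)
  simp only [neg_add_eq_sub]
  ring

/-- Mollification commutes with weak differentiation. -/
theorem fderiv_convolution_eq_of_weak {n : ℕ} {a b : Rn n → ℝ} {v : Rn n}
    (ha : LocallyIntegrable a volume)
    (hab : ∀ θ : Rn n → ℝ, ContDiff ℝ ∞ θ → HasCompactSupport θ →
      ∫ x, fderiv ℝ θ x v * a x = - ∫ x, θ x * b x)
    {ρ : Rn n → ℝ} (hρ : ContDiff ℝ ∞ ρ) (hρc : HasCompactSupport ρ) (x : Rn n) :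
    fderiv ℝ (ρ ⋆[ContinuousLinearMap.lsmul ℝ ℝ, volume] a) x v =
      (ρ ⋆[ContinuousLinearMap.lsmul ℝ ℝ, volume] b) x := by
  have h1 := hρc.hasFDerivAt_convolution_left (ContinuousLinearMap.lsmul ℝ ℝ)
    (hρ.of_le (by exact_mod_cast le_top)) ha x
  have hfd : Continuous (fderiv ℝ ρ) := hρ.continuous_fderiv (by simp)
  have hconv : ConvolutionExistsAt (fderiv ℝ ρ) a x
      ((ContinuousLinearMap.lsmul ℝ ℝ).precompL (Rn n)) volume :=
    (hρc.fderiv (𝕜 := ℝ)).convolutionExists_left _ hfd ha x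
  rw [h1.fderiv, convolution_eq_swap, convolution_eq_swap,
    ContinuousLinearMap.integral_apply hconv.integrable_swap]
  -- The reflected kernel is the test function; the sign from the reflection cancels the sign in the
  -- weak derivative.
  have hθ : ContDiff ℝ ∞ fun t => ρ (x - t) := hρ.comp (contDiff_const.sub contDiff_id)
  have hθc : HasCompactSupport fun t => ρ (x - t) :=
    hρc.comp_homeomorph (Homeomorph.subLeft x)
  have h2 := hab _ hθ hθc
  have h3 : ∀ t, fderiv ℝ (fun t => ρ (x - t)) t v = - fderiv ℝ ρ (x - t) v := by
    intro t
    have e1 : HasFDerivAt ρ (fderiv ℝ ρ (x - t)) (x - t) :=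
      (hρ.differentiable (by simp) _).hasFDerivAt
    have e2 : HasFDerivAt (fun t => x - t) (-ContinuousLinearMap.id ℝ (Rn n)) t :=
      (hasFDerivAt_id t).const_sub x
    have e3 := e1.comp t e2
    rw [show (fun t => ρ (x - t)) = ρ ∘ fun t => x - t from rfl, e3.fderiv]
    simp
  simp only [h3, neg_mul, integral_neg, neg_inj] at h2
  simpa using h2

/-- The square of a real function in `L²` with weak partial derivative in `L²`. -/
theorem integral_fderiv_mul_sq_of_weak {n : ℕ} {a b : Rn n → ℝ} {v : Rn n}
    (ha : MemLp a 2 volume) (hb : MemLp b 2 volume)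
    (hab : ∀ θ : Rn n → ℝ, ContDiff ℝ ∞ θ → HasCompactSupport θ →
      ∫ x, fderiv ℝ θ x v * a x = - ∫ x, θ x * b x)
    {θ : Rn n → ℝ} (hθ : ContDiff ℝ ∞ θ) (hθc : HasCompactSupport θ) :
    ∫ x, fderiv ℝ θ x v * a x ^ 2 = - ∫ x, θ x * (2 * (a x * b x)) := by
  have ha' := ha.locallyIntegrable (by norm_num)
  have hb' := hb.locallyIntegrable (by norm_num)
  have hfc : Continuous fun x => fderiv ℝ θ x v :=
    (hθ.continuous_fderiv (by simp)).clm_apply continuous_const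
  have hfs : HasCompactSupport fun x => fderiv ℝ θ x v := hθc.fderiv_apply ℝ v
  obtain ⟨φ, hφ⟩ : ∃ φ : ℕ → ContDiffBump (0 : Rn n),
      Tendsto (fun k => (φ k).rOut) atTop (𝓝 0) := by
    refine ⟨fun k => ⟨1 / (2 * ((k : ℝ) + 1)), 1 / ((k : ℝ) + 1), by positivity, ?_⟩, ?_⟩
    · apply one_div_lt_one_div_of_lt <;> linarith [(k.cast_nonneg : (0 : ℝ) ≤ k)]
    · exact tendsto_one_div_add_atTop_nhds_zero_nat
  have hM {c : Rn n → ℝ} (hc : MemLp c 2 volume) {η : Rn n → ℝ} (hη : Continuous η)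
      (hηc : HasCompactSupport η) : MemLp (fun x => η x * c x) 2 volume :=
    hc.mul (p := ⊤) (r := 2) (hη.memLp_top_of_hasCompactSupport hηc volume)
  let A : ℕ → Rn n → ℝ := fun k =>
    (φ k).normed volume ⋆[ContinuousLinearMap.lsmul ℝ ℝ, volume] a
  let B : ℕ → Rn n → ℝ := fun k =>
    (φ k).normed volume ⋆[ContinuousLinearMap.lsmul ℝ ℝ, volume] b
  have hA : ∀ k, ContDiff ℝ ∞ (A k) := fun k =>
    (φ k).hasCompactSupport_normed.contDiff_convolution_left _ (φ k).contDiff_normed ha'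
  have hB : ∀ k, Continuous (B k) := fun k =>
    (φ k).hasCompactSupport_normed.continuous_convolution_left _ (φ k).continuous_normed hb'
  -- Test with `θ A k`, where `A k` is the mollified `a` and has derivative `B k`. Each integral
  -- pairs a fixed `L²` function with a mollification, so weak convergence suffices; the two limits
  -- `∫ θ a b` produce the factor 2.
  have key : ∀ k, (∫ x, (fderiv ℝ θ x v * a x) * A k x) + ∫ x, (θ x * a x) * B k x =
      - ∫ x, (θ x * b x) * A k x := by
    intro k
    have h := hab (fun x => θ x * A k x) (hθ.mul (hA k)) hθc.mul_right
    have e : ∀ x, fderiv ℝ (fun x => θ x * A k x) x v =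
        fderiv ℝ θ x v * A k x + θ x * B k x := by
      intro x
      rw [fderiv_fun_mul (hθ.differentiable (by simp) x) ((hA k).differentiable (by simp) x)]
      simp only [add_apply, smul_apply, smul_eq_mul]
      rw [fderiv_convolution_eq_of_weak ha' hab (φ k).contDiff_normed
        (φ k).hasCompactSupport_normed x]
      ring
    simp only [e] at h
    rw [← integral_add]
    · calc _ = ∫ x, (fderiv ℝ θ x v * A k x + θ x * B k x) * a x := by congr 1; ext x; ring
        _ = _ := h
        _ = _ := by congr 2; ext x; ring
    · refine (ha'.integrable_smul_left_of_hasCompactSupport (hfc.mul (hA k).continuous)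
        hfs.mul_right).congr (ae_of_all _ fun x => ?_)
      simp only [smul_eq_mul, Pi.mul_apply]; ring
    · refine (ha'.integrable_smul_left_of_hasCompactSupport (hθ.continuous.mul (hB k))
        hθc.mul_right).congr (ae_of_all _ fun x => ?_)
      simp only [smul_eq_mul, Pi.mul_apply]; ring
  have l1 := tendsto_integral_mul_mollify (hM ha hfc hfs) ha hφ
  have l2 := tendsto_integral_mul_mollify (hM ha hθ.continuous hθc) hb hφ
  have l3 := (tendsto_integral_mul_mollify (hM hb hθ.continuous hθc) ha hφ).neg
  have l4 := tendsto_nhds_unique ((l1.add l2).congr key) l3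
  have i : ∀ x, fderiv ℝ θ x v * a x ^ 2 = fderiv ℝ θ x v * a x * a x := fun x => by ring
  have i' : ∀ x, θ x * (2 * (a x * b x)) = 2 * (θ x * a x * b x) := fun x => by ring
  have i'' : ∀ x, θ x * b x * a x = θ x * a x * b x := fun x => by ring
  simp only [i, i', integral_const_mul]
  simp only [i''] at l4
  linarith

/-! ### Coordinates, and the weak gradient of `|f|²` -/

theorem MeasureTheory.LocallyIntegrable.euclidean_apply {n : ℕ} {g : Rn n → Cn n}
    (hg : LocallyIntegrable g volume) (j : Fin n) : LocallyIntegrable (fun x => g x j) volume :=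
  fun x => by
    obtain ⟨s, hs, hi⟩ := hg x
    exact ⟨s, hs, (EuclideanSpace.proj (𝕜 := ℂ) j).integrable_comp hi⟩

theorem MeasureTheory.MemLp.euclidean_apply {n : ℕ} {g : Rn n → Cn n}
    (hg : MemLp g 2 volume) (j : Fin n) : MemLp (fun x => g x j) 2 volume :=
  (EuclideanSpace.proj (𝕜 := ℂ) j).comp_memLp' hg

/-- Cauchy–Schwarz: as `x` is real, the bilinear sum is a Hermitian inner product. -/
theorem norm_xDot_le {n : ℕ} (g : Rn n → Cn n) (x : Rn n) : ‖xDot g x‖ ≤ ‖x‖ * ‖g x‖ := by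
  let ι : Cn n := WithLp.toLp 2 fun j => ((x j : ℝ) : ℂ)
  have h1 : xDot g x = inner ℂ ι (g x) := by
    simp [xDot, ι, PiLp.inner_apply, mul_comm]
  have h2 : ‖ι‖ = ‖x‖ := by simp [ι, EuclideanSpace.norm_eq]
  rw [h1, ← h2]
  exact norm_inner_le_norm _ _

theorem aestronglyMeasurable_xDot {n : ℕ} {g : Rn n → Cn n}
    (hg : AEStronglyMeasurable g volume) : AEStronglyMeasurable (xDot g) volume := by
  unfold xDot
  refine Finset.aestronglyMeasurable_fun_sum _ fun j _ => ?_
  refine AEStronglyMeasurable.mul ?_ ?_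
  · exact (Complex.continuous_ofReal.comp
      (EuclideanSpace.proj (𝕜 := ℝ) j).continuous).aestronglyMeasurable
  · exact (EuclideanSpace.proj (𝕜 := ℂ) j).continuous.comp_aestronglyMeasurable hg

/-- `|f|²` has the weak gradient `2 Re (f̄ ∇f)` when `f ∈ H¹`. -/
theorem InH1.integral_fderiv_mul_norm_sq {n : ℕ} {f : Rn n → ℂ} {g : Rn n → Cn n}
    (hf : InH1 f g) (j : Fin n) {θ : Rn n → ℝ} (hθ : ContDiff ℝ ∞ θ)
    (hθc : HasCompactSupport θ) :
    ∫ x, fderiv ℝ θ x (EuclideanSpace.single j 1) * ‖f x‖ ^ 2 =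
      - ∫ x, θ x * (2 * (conj (f x) * g x j).re) := by
  have hgj := hf.memLp_grad.euclidean_apply j
  have hli := hf.isWeakGradient.locallyIntegrable_grad.euclidean_apply j
  have hfc {η : Rn n → ℝ} (hη : ContDiff ℝ ∞ η) :
      Continuous fun x => fderiv ℝ η x (EuclideanSpace.single j 1) :=
    (hη.continuous_fderiv (by simp)).clm_apply continuous_const
  have hL {η : Rn n → ℝ} (hη : ContDiff ℝ ∞ η) (hηc : HasCompactSupport η) :
      Integrable fun x => fderiv ℝ η x (EuclideanSpace.single j 1) • f x :=
    hf.isWeakGradient.locallyIntegrable.integrable_smul_left_of_hasCompactSupport (hfc hη)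
      (hηc.fderiv_apply ℝ _)
  have hR {η : Rn n → ℝ} (hη : ContDiff ℝ ∞ η) (hηc : HasCompactSupport η) :
      Integrable fun x => η x • g x j :=
    hli.integrable_smul_left_of_hasCompactSupport hη.continuous hηc
  have hfr : MemLp (fun x => (f x).re) 2 volume := hf.memLp.re
  have hfi : MemLp (fun x => (f x).im) 2 volume := hf.memLp.im
  have hgr : MemLp (fun x => (g x j).re) 2 volume := hgj.re
  have hgi : MemLp (fun x => (g x j).im) 2 volume := hgj.im
  -- Test functions are real, so the weak gradient identity splits into real and imaginary parts.
  have re := integral_fderiv_mul_sq_of_weak (v := EuclideanSpace.single j 1)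
    hfr hgr (fun η hη hηc => by
      have h := congrArg Complex.re (hf.isWeakGradient.integral_eq j η hη hηc)
      rw [Complex.neg_re] at h
      have a := Complex.reCLM.integral_comp_comm (hL hη hηc)
      have b := Complex.reCLM.integral_comp_comm (hR hη hηc)
      simp only [Complex.reCLM_apply, Complex.smul_re, smul_eq_mul] at a b
      rw [a, b, h]) hθ hθc
  have im := integral_fderiv_mul_sq_of_weak (v := EuclideanSpace.single j 1)
    hfi hgi (fun η hη hηc => by
      have h := congrArg Complex.im (hf.isWeakGradient.integral_eq j η hη hηc)
      rw [Complex.neg_im] at h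
      have a := Complex.imCLM.integral_comp_comm (hL hη hηc)
      have b := Complex.imCLM.integral_comp_comm (hR hη hηc)
      simp only [Complex.imCLM_apply, Complex.smul_im, smul_eq_mul] at a b
      rw [a, b, h]) hθ hθc
  have s1 {c : Rn n → ℝ} (hc : MemLp c 2 volume) :
      Integrable fun x => fderiv ℝ θ x (EuclideanSpace.single j 1) * c x ^ 2 :=
    hc.integrable_sq.locallyIntegrable.integrable_smul_left_of_hasCompactSupport (hfc hθ)
      (hθc.fderiv_apply ℝ _)
  have s2 {c d : Rn n → ℝ} (hc : MemLp c 2 volume) (hd : MemLp d 2 volume) :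
      Integrable fun x => θ x * (2 * (c x * d x)) :=
    ((hc.integrable_mul hd).const_mul 2).locallyIntegrable.integrable_smul_left_of_hasCompactSupport
      hθ.continuous hθc
  calc _ = ∫ x, (fderiv ℝ θ x (EuclideanSpace.single j 1) * (f x).re ^ 2 +
        fderiv ℝ θ x (EuclideanSpace.single j 1) * (f x).im ^ 2) := by
        congr 1; ext x; rw [← Complex.normSq_eq_norm_sq, Complex.normSq_apply]; ring
    _ = -((∫ x, θ x * (2 * ((f x).re * (g x j).re))) +
        ∫ x, θ x * (2 * ((f x).im * (g x j).im))) := by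
        rw [integral_add (s1 hfr) (s1 hfi), re, im]; ring
    _ = _ := by
        rw [← integral_add (s2 hfr hgr) (s2 hfi hgi)]
        congr 2; ext x; simp only [Complex.mul_re, Complex.conj_re, Complex.conj_im]; ring

/-! ### The weak divergence identity for radial fields -/

/-- The product rule for the divergence of `η(y) y`; by linearity `∑ xⱼ ∂ⱼη` is the derivative of
`η` in the direction `x`. -/
theorem sum_fderiv_coord_mul {n : ℕ} {η : Rn n → ℝ} (hη : Differentiable ℝ η) (x : Rn n) :
    ∑ j : Fin n, fderiv ℝ (fun y : Rn n => y j * η y) x (EuclideanSpace.single j 1) =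
      n * η x + fderiv ℝ η x x := by
  have h : ∀ j : Fin n, fderiv ℝ (fun y : Rn n => y j * η y) x (EuclideanSpace.single j 1) =
      η x + x j * fderiv ℝ η x (EuclideanSpace.single j 1) := by
    intro j
    have e := ((EuclideanSpace.proj (𝕜 := ℝ) j).hasFDerivAt (x := x)).mul (hη x).hasFDerivAt
    have : (fun y : Rn n => y j * η y) = (EuclideanSpace.proj (𝕜 := ℝ) j : Rn n → ℝ) * η := rfl
    rw [this, e.fderiv]
    simp
    ring
  have hx : x = ∑ j : Fin n, x j • EuclideanSpace.single j (1 : ℝ) := by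
    ext i; simp [Finset.sum_apply, Pi.single_apply]
  simp only [h, Finset.sum_add_distrib, Finset.sum_const, Finset.card_univ, Fintype.card_fin,
    nsmul_eq_mul]
  conv_rhs => rw [show fderiv ℝ η x x = fderiv ℝ η x (∑ j : Fin n, x j • EuclideanSpace.single j
    (1 : ℝ)) from congrArg _ hx]
  simp only [map_sum, map_smul, smul_eq_mul]

/-- The weak divergence identity for the field `η(x) x` with compactly supported `η`. -/
theorem InH1.integral_norm_sq_mul_div_of_hasCompactSupport {n : ℕ} {f : Rn n → ℂ}
    {g : Rn n → Cn n} (hf : InH1 f g) {η : Rn n → ℝ} (hη : ContDiff ℝ ∞ η)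
    (hηc : HasCompactSupport η) :
    ∫ x, (n * η x + fderiv ℝ η x x) * ‖f x‖ ^ 2 =
      - ∫ x, η x * (2 * (conj (f x) * xDot g x).re) := by
  have hc : ∀ j : Fin n, ContDiff ℝ ∞ fun y : Rn n => y j * η y := fun j =>
    (EuclideanSpace.proj (𝕜 := ℝ) j).contDiff.mul hη
  have h := Finset.sum_congr (rfl : (Finset.univ : Finset (Fin n)) = _) fun j _ =>
    hf.integral_fderiv_mul_norm_sq j (hc j) hηc.mul_left
  rw [Finset.sum_neg_distrib, ← integral_finsetSum, ← integral_finsetSum] at h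
  · simp only [← Finset.sum_mul, sum_fderiv_coord_mul (hη.differentiable (by simp))] at h
    rw [h]
    congr 2
    ext x
    simp only [xDot, Finset.mul_sum, Complex.re_sum]
    refine Finset.sum_congr rfl fun j _ => ?_
    simp only [Complex.mul_re, Complex.mul_im, Complex.ofReal_re, Complex.ofReal_im,
      Complex.conj_re, Complex.conj_im]
    ring
  · intro j _
    have i : Integrable fun x => 2 * (conj (f x) * g x j).re :=
      ((hf.memLp.star.integrable_mul (hf.memLp_grad.euclidean_apply j)).re).const_mul 2
    exact i.locallyIntegrable.integrable_smul_left_of_hasCompactSupport (hc j).continuous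
      hηc.mul_left
  · intro j _
    have i : Integrable fun x => ‖f x‖ ^ 2 := hf.memLp.norm.integrable_sq
    exact i.locallyIntegrable.integrable_smul_left_of_hasCompactSupport
      (((hc j).continuous_fderiv (by simp)).clm_apply continuous_const)
      (HasCompactSupport.fderiv_apply ℝ hηc.mul_left _)

/-- The weak divergence identity for the field `w(x) x` with bounded `w` and `x · ∇w`. -/
theorem InH1.integral_norm_sq_mul_div {n : ℕ} {f : Rn n → ℂ} {g : Rn n → Cn n}
    (hf : InH1 f g) {w : Rn n → ℝ} (hw : ContDiff ℝ ∞ w) {M : ℝ} (hM : ∀ x, |w x| ≤ M)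
    (hM' : ∀ x, |fderiv ℝ w x x| ≤ M)
    (hi : Integrable fun x => w x * (2 * (conj (f x) * xDot g x).re)) :
    ∫ x, (n * w x + fderiv ℝ w x x) * ‖f x‖ ^ 2 =
      - ∫ x, w x * (2 * (conj (f x) * xDot g x).re) := by
  let χ : ContDiffBump (0 : Rn n) := default
  -- The operator `x·∇` is scale invariant: applied to the cutoff `χ(s x)` it gives `D(s x)`,
  -- bounded uniformly in `s` and tending to `D 0 = 0`. Hence the cutoff leaves no error in the
  -- limit, although the field grows like `|x|`.
  let D : Rn n → ℝ := fun y => fderiv ℝ χ y y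
  have hχ : ContDiff ℝ ∞ χ := χ.contDiff
  have hDc : Continuous D := (hχ.continuous_fderiv (by simp)).clm_apply continuous_id
  obtain ⟨K, hK⟩ : ∃ K, ∀ y, ‖D y‖ ≤ K := by
    refine hDc.bounded_above_of_compact_support ?_
    refine HasCompactSupport.mono (χ.hasCompactSupport.fderiv (𝕜 := ℝ)) fun y hy hy' => hy ?_
    simp [D, hy']
  let s : ℕ → ℝ := fun k => 1 / ((k : ℝ) + 1)
  have hs : ∀ k, s k ≠ 0 := fun k => by positivity
  have hs0 : Tendsto s atTop (𝓝 0) := tendsto_one_div_add_atTop_nhds_zero_nat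
  let X : ℕ → Rn n → ℝ := fun k x => χ (s k • x)
  have hX : ∀ k, ContDiff ℝ ∞ (X k) := fun k => hχ.comp (contDiff_const_smul _)
  have hXc : ∀ k, HasCompactSupport (X k) := fun k =>
    χ.hasCompactSupport.comp_homeomorph (Homeomorph.smulOfNeZero (s k) (hs k))
  have hXD : ∀ k x, fderiv ℝ (X k) x x = D (s k • x) := by
    intro k x
    have e1 := (hχ.differentiable (by simp) (s k • x)).hasFDerivAt
    have e2 := ((hasFDerivAt_id (𝕜 := ℝ) x).const_smul (s k))
    have e3 := e1.comp x e2
    rw [show X k = χ ∘ HSMul.hSMul (s k) from rfl, e3.fderiv]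
    simp [D]
  have hlim : ∀ x : Rn n, Tendsto (fun k => s k • x) atTop (𝓝 0) := fun x => by
    simpa using hs0.smul_const x
  have hXl : ∀ x, Tendsto (fun k => X k x) atTop (𝓝 1) := fun x => by
    have := (hχ.continuous.tendsto 0).comp (hlim x)
    rwa [χ.one_of_mem_closedBall (Metric.mem_closedBall_self χ.rIn_pos.le)] at this
  have hDl : ∀ x, Tendsto (fun k => D (s k • x)) atTop (𝓝 0) := fun x => by
    have := (hDc.tendsto 0).comp (hlim x)
    rwa [show D 0 = 0 by simp [D]] at this
  have hX1 : ∀ k x, |X k x| ≤ 1 := fun k x => abs_le.2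
    ⟨by linarith [(χ.nonneg : 0 ≤ χ (s k • x))], χ.le_one⟩
  have hsq : Integrable fun x => ‖f x‖ ^ 2 := hf.memLp.norm.integrable_sq
  have hfw : Continuous fun x => fderiv ℝ w x x :=
    (hw.continuous_fderiv (by simp)).clm_apply continuous_id
  have key : ∀ k, ∫ x, (X k x * (n * w x + fderiv ℝ w x x) + w x * D (s k • x)) * ‖f x‖ ^ 2 =
      - ∫ x, X k x * (w x * (2 * (conj (f x) * xDot g x).re)) := by
    intro k
    have h := hf.integral_norm_sq_mul_div_of_hasCompactSupport ((hX k).mul hw)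
      ((hXc k).mul_right)
    have e : ∀ x, fderiv ℝ (fun x => X k x * w x) x x =
        w x * D (s k • x) + X k x * fderiv ℝ w x x := fun x => by
      rw [fderiv_fun_mul ((hX k).differentiable (by simp) x) (hw.differentiable (by simp) x)]
      simp only [add_apply, smul_apply, smul_eq_mul, hXD]
      ring
    simp only [e] at h
    calc _ = _ := by congr 1; ext x; ring
      _ = _ := h
      _ = _ := by congr 2; ext x; ring
  have l1 : Tendsto (fun k => ∫ x, (X k x * (n * w x + fderiv ℝ w x x) + w x * D (s k • x)) *
      ‖f x‖ ^ 2) atTop (𝓝 (∫ x, (n * w x + fderiv ℝ w x x) * ‖f x‖ ^ 2)) := by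
    refine tendsto_integral_of_dominated_convergence
      (fun x => (n * M + M + M * K) * ‖f x‖ ^ 2) ?_ (hsq.const_mul _) ?_ ?_
    · intro k
      refine Continuous.aestronglyMeasurable ?_ |>.mul hsq.aestronglyMeasurable
      exact ((hX k).continuous.mul ((continuous_const.mul hw.continuous).add hfw)).add
        (hw.continuous.mul (hDc.comp (continuous_const_smul _)))
    · intro k
      refine ae_of_all _ fun x => ?_
      rw [norm_mul, norm_pow, norm_norm]
      refine mul_le_mul_of_nonneg_right ?_ (by positivity)
      have hM0 : 0 ≤ M := (abs_nonneg _).trans (hM x)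
      have h1 : |(n : ℝ) * w x + fderiv ℝ w x x| ≤ n * M + M := by
        refine (abs_add_le _ _).trans (add_le_add ?_ (hM' x))
        rw [abs_mul, Nat.abs_cast]
        exact mul_le_mul_of_nonneg_left (hM x) (Nat.cast_nonneg n)
      refine (abs_add_le _ _).trans (add_le_add ?_ ?_)
      · rw [abs_mul]
        calc _ ≤ 1 * (n * M + M) := mul_le_mul (hX1 k x) h1 (abs_nonneg _) zero_le_one
          _ = _ := one_mul _
      · rw [abs_mul]
        exact mul_le_mul (hM x) (hK _) (abs_nonneg _) hM0
    · refine ae_of_all _ fun x => ?_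
      have := (((hXl x).mul_const (n * w x + fderiv ℝ w x x)).add
        ((hDl x).const_mul (w x))).mul_const (‖f x‖ ^ 2)
      simpa using this
  have l2 : Tendsto (fun k => ∫ x, X k x * (w x * (2 * (conj (f x) * xDot g x).re))) atTop
      (𝓝 (∫ x, w x * (2 * (conj (f x) * xDot g x).re))) := by
    refine tendsto_integral_of_dominated_convergence _ ?_ hi.norm ?_ ?_
    · exact fun k => (hX k).continuous.aestronglyMeasurable.mul hi.aestronglyMeasurable
    · intro k
      refine ae_of_all _ fun x => ?_
      rw [norm_mul]
      exact mul_le_of_le_one_left (norm_nonneg _) (hX1 k x)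
    · refine ae_of_all _ fun x => ?_
      simpa using (hXl x).mul_const (w x * (2 * (conj (f x) * xDot g x).re))
  exact tendsto_nhds_unique (l1.congr key) l2.neg

/-! ### Expansion of squares and the dilation equality -/

theorem integrable_sq_norm {n : ℕ} {F : Type*} [NormedAddCommGroup F] {f : Rn n → F}
    (hf : MemLp f 2 volume) : Integrable fun x => ‖f x‖ ^ 2 :=
  hf.norm.integrable_sq

theorem l2_sq {n : ℕ} {F : Type*} [NormedAddCommGroup F] {f : Rn n → F}
    (hf : MemLp f 2 volume) : l2 f ^ 2 = ∫ x, ‖f x‖ ^ 2 := by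
  have h : l2 f = (∫ x, ‖f x‖ ^ 2) ^ ((2 : ℝ)⁻¹) := by
    rw [l2, lpNorm_eq_integral_norm_rpow_toReal (by norm_num) (by norm_num)
      hf.aestronglyMeasurable]
    simp
  rw [h, ← Real.rpow_natCast, ← Real.rpow_mul (integral_nonneg fun x => by positivity)]
  simp

theorem l2_congr {n : ℕ} {F : Type*} [NormedAddCommGroup F] {f f' : Rn n → F}
    (h : f =ᵐ[volume] f') : l2 f = l2 f' := by
  classical
  simp only [l2, lpNorm, eLpNorm_congr_ae h, aestronglyMeasurable_congr h]

theorem integrable_two_mul_re_conj_mul {n : ℕ} {F K : Rn n → ℂ} (hF : MemLp F 2 volume)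
    (hK : MemLp K 2 volume) : Integrable fun x => 2 * (conj (K x) * F x).re :=
  ((hK.star.integrable_mul hF).re).const_mul 2

/-- Used with `c = n/2` (dilation), `c = (n-2)/2` (Hardy) and `c = -1` (the relation between the
two). -/
theorem l2_sq_add_const_mul {n : ℕ} {F K : Rn n → ℂ} (hF : MemLp F 2 volume)
    (hK : MemLp K 2 volume) (c : ℝ) :
    l2 (fun x => F x + c * K x) ^ 2 =
      l2 F ^ 2 + c * (∫ x, 2 * (conj (K x) * F x).re) + c ^ 2 * l2 K ^ 2 := by
  have hFK : MemLp (fun x => F x + c * K x) 2 volume := hF.add (hK.const_mul (c : ℂ))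
  rw [l2_sq hFK, l2_sq hF, l2_sq hK, ← integral_const_mul,
    ← integral_const_mul, ← integral_add (integrable_sq_norm hF)
      ((integrable_two_mul_re_conj_mul hF hK).const_mul c), ← integral_add]
  · congr 1
    ext x
    simp only [← Complex.normSq_eq_norm_sq, Complex.normSq_apply]
    simp
    ring
  · exact (integrable_sq_norm hF).add ((integrable_two_mul_re_conj_mul hF hK).const_mul c)
  · exact (integrable_sq_norm hK).const_mul _

/-- The weight `w = 1` shows that the cross term is `-n‖φ‖²`; with `c = n/2`, `-n c + c² = -(n/2)²`.
-/
theorem dilationEqualityHolds (n : ℕ) : DilationEqualityHolds n := by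
  intro φ h hφ hX
  have hi := integrable_two_mul_re_conj_mul hX hφ.memLp
  have key := hφ.integral_norm_sq_mul_div (w := fun _ => 1) contDiff_const (M := 1)
    (by simp) (by simp) (by simpa using hi)
  simp only [fderiv_fun_const, Pi.zero_apply, zero_apply, mul_one, add_zero,
    one_mul, integral_const_mul] at key
  rw [← l2_sq hφ.memLp] at key
  have e : dilationRemainder φ h = fun x => xDot h x + ((n / 2 : ℝ) : ℂ) * φ x := by
    ext x; simp [dilationRemainder]
  rw [DilationEquality, e, l2_sq_add_const_mul hX hφ.memLp, integral_const_mul]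
  linear_combination (-(n : ℝ) / 2) * key

/-! ### Regularized weights and square integrability of `ψ/|x|` -/

/-- The regularization `(|x|² + ε)⁻¹` of `|x|⁻²`. -/
noncomputable def regInvSq {n : ℕ} (ε : ℝ) (x : Rn n) : ℝ := (‖x‖ ^ 2 + ε)⁻¹

section regInvSq

variable {n : ℕ} {ε : ℝ}

theorem contDiff_regInvSq (hε : 0 < ε) : ContDiff ℝ ∞ (regInvSq (n := n) ε) :=
  ((contDiff_norm_sq ℝ).add contDiff_const).inv fun x => by positivity

theorem fderiv_regInvSq (hε : 0 < ε) (x : Rn n) :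
    fderiv ℝ (regInvSq ε) x x = -(2 * ‖x‖ ^ 2 * regInvSq ε x ^ 2) := by
  have h0 : ‖x‖ ^ 2 + ε ≠ 0 := by positivity
  have e := (hasDerivAt_inv h0).comp_hasFDerivAt x
    ((hasStrictFDerivAt_norm_sq x).hasFDerivAt.add_const ε)
  have : regInvSq ε = Inv.inv ∘ fun y : Rn n => ‖y‖ ^ 2 + ε := rfl
  rw [this, e.fderiv]
  simp
  field_simp

theorem regInvSq_pos (hε : 0 < ε) (x : Rn n) : 0 < regInvSq ε x := by
  unfold regInvSq; positivity

theorem norm_sq_mul_regInvSq_le (hε : 0 < ε) (x : Rn n) : ‖x‖ ^ 2 * regInvSq ε x ≤ 1 := by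
  unfold regInvSq
  rw [← div_eq_mul_inv, div_le_one (by positivity)]
  linarith

theorem regInvSq_le_inv (hε : 0 < ε) (x : Rn n) : regInvSq ε x ≤ ε⁻¹ := by
  unfold regInvSq
  exact inv_anti₀ hε (by linarith [sq_nonneg ‖x‖])

theorem regInvSq_le (hε : 0 < ε) {x : Rn n} (hx : x ≠ 0) : regInvSq ε x ≤ (‖x‖ ^ 2)⁻¹ := by
  unfold regInvSq
  have := norm_pos_iff.2 hx
  exact inv_anti₀ (by positivity) (by linarith)

theorem tendsto_regInvSq {x : Rn n} (hx : x ≠ 0) :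
    Tendsto (fun k : ℕ => regInvSq (1 / ((k : ℝ) + 1)) x) atTop (𝓝 (‖x‖ ^ 2)⁻¹) := by
  unfold regInvSq
  have h := (tendsto_one_div_add_atTop_nhds_zero_nat (𝕜 := ℝ)).const_add (‖x‖ ^ 2)
  rw [add_zero] at h
  exact h.inv₀ (by simpa using hx)

end regInvSq

theorem InH1.integrable_regInvSq_mul {n : ℕ} {f : Rn n → ℂ} {g : Rn n → Cn n}
    (hf : InH1 f g) {ε : ℝ} (hε : 0 < ε) :
    Integrable fun x => regInvSq ε x * (2 * (conj (f x) * xDot g x).re) := by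
  refine (((integrable_sq_norm hf.memLp).add (integrable_sq_norm hf.memLp_grad)).const_mul
    (1 + ε⁻¹)).mono' ?_ (ae_of_all _ fun x => ?_)
  · refine (contDiff_regInvSq hε).continuous.aestronglyMeasurable.mul ?_
    exact (Complex.continuous_re.comp_aestronglyMeasurable
      (hf.memLp.aestronglyMeasurable.star.mul
        (aestronglyMeasurable_xDot hf.memLp_grad.aestronglyMeasurable))).const_mul 2
  · have h1 : |(conj (f x) * xDot g x).re| ≤ ‖f x‖ * (‖x‖ * ‖g x‖) := by
      refine (Complex.abs_re_le_norm _).trans ?_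
      rw [norm_mul, RCLike.norm_conj]
      exact mul_le_mul_of_nonneg_left (norm_xDot_le g x) (norm_nonneg _)
    have h2 := regInvSq_pos hε x
    -- From `|x| ≤ 1 + |x|²`, each summand being bounded after multiplication by the weight.
    have h3 : regInvSq ε x * ‖x‖ ≤ 1 + ε⁻¹ := by
      have := norm_sq_mul_regInvSq_le hε x
      have := regInvSq_le_inv hε x
      nlinarith [sq_nonneg (‖x‖ - 1)]
    simp only [Real.norm_eq_abs, abs_mul, abs_of_pos h2, Nat.abs_ofNat, Pi.add_apply]
    calc _ ≤ regInvSq ε x * (2 * (‖f x‖ * (‖x‖ * ‖g x‖))) := by gcongr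
      _ = (regInvSq ε x * ‖x‖) * (2 * ‖f x‖ * ‖g x‖) := by ring
      _ ≤ (1 + ε⁻¹) * (2 * ‖f x‖ * ‖g x‖) := by gcongr
      _ ≤ _ := by gcongr; exact two_mul_le_add_sq _ _

theorem InH1.integral_regInvSq {n : ℕ} {f : Rn n → ℂ} {g : Rn n → Cn n}
    (hf : InH1 f g) {ε : ℝ} (hε : 0 < ε) :
    ∫ x, (n * regInvSq ε x - 2 * ‖x‖ ^ 2 * regInvSq ε x ^ 2) * ‖f x‖ ^ 2 =
      - ∫ x, regInvSq ε x * (2 * (conj (f x) * xDot g x).re) := by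
  have := hf.integral_norm_sq_mul_div (contDiff_regInvSq hε) (M := 2 * ε⁻¹)
    (fun x => by
      rw [abs_of_pos (regInvSq_pos hε x)]
      linarith [regInvSq_le_inv hε x, inv_pos.2 hε])
    (fun x => by
      have h1 := norm_sq_mul_regInvSq_le hε x
      have h2 := regInvSq_pos hε x
      have h3 := regInvSq_le_inv hε x
      rw [fderiv_regInvSq hε, abs_neg, abs_of_nonneg (by positivity)]
      nlinarith)
    (hf.integrable_regInvSq_mul hε)
  simpa only [fderiv_regInvSq hε, ← sub_eq_add_neg] using this

theorem InH1.integrable_regInvSq_mul_norm_sq {n : ℕ} {f : Rn n → ℂ} {g : Rn n → Cn n}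
    (hf : InH1 f g) {ε : ℝ} (hε : 0 < ε) : Integrable fun x => regInvSq ε x * ‖f x‖ ^ 2 := by
  refine ((integrable_sq_norm hf.memLp).const_mul ε⁻¹).mono' ?_ (ae_of_all _ fun x => ?_)
  · exact (contDiff_regInvSq hε).continuous.aestronglyMeasurable.mul
      (integrable_sq_norm hf.memLp).aestronglyMeasurable
  · rw [Real.norm_of_nonneg (mul_nonneg (regInvSq_pos hε x).le (by positivity))]
    exact mul_le_mul_of_nonneg_right (regInvSq_le_inv hε x) (by positivity)

/-- With `r` the weight, `|x|² r ≤ 1` and `n ≥ 3` give `n r - 2|x|² r² ≥ (n-2) r ≥ r`. On the other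
side `2 r |f||x||g| ≤ r|f|²/2 + 2|g|²`, and the first term is absorbed. The constant 4 is not sharp
in general; only its independence of `ε` matters. -/
theorem InH1.integral_regInvSq_mul_norm_sq_le {n : ℕ} (hn : 3 ≤ n) {f : Rn n → ℂ}
    {g : Rn n → Cn n} (hf : InH1 f g) {ε : ℝ} (hε : 0 < ε) :
    ∫ x, regInvSq ε x * ‖f x‖ ^ 2 ≤ 4 * ∫ x, ‖g x‖ ^ 2 := by
  have key := hf.integral_regInvSq hε
  have hu := hf.integrable_regInvSq_mul_norm_sq hε
  have hn' : (3 : ℝ) ≤ n := by exact_mod_cast hn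
  have l : ∫ x, regInvSq ε x * ‖f x‖ ^ 2 ≤
      ∫ x, (n * regInvSq ε x - 2 * ‖x‖ ^ 2 * regInvSq ε x ^ 2) * ‖f x‖ ^ 2 := by
    refine integral_mono hu ?_ fun x => ?_
    · refine ((hu.const_mul (n + 2)).mono' ?_ (ae_of_all _ fun x => ?_))
      · refine Continuous.aestronglyMeasurable ?_ |>.mul
          (integrable_sq_norm hf.memLp).aestronglyMeasurable
        have := (contDiff_regInvSq (n := n) hε).continuous
        fun_prop
      · have h1 := norm_sq_mul_regInvSq_le hε x
        have h2 := regInvSq_pos hε x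
        have h4 : 0 ≤ ‖x‖ ^ 2 * regInvSq ε x := by positivity
        rw [norm_mul, norm_pow, norm_norm, ← mul_assoc]
        refine mul_le_mul_of_nonneg_right ?_ (by positivity)
        rw [Real.norm_eq_abs, abs_le]
        constructor <;> nlinarith
    · have h1 := norm_sq_mul_regInvSq_le hε x
      have h2 := regInvSq_pos hε x
      refine mul_le_mul_of_nonneg_right ?_ (by positivity)
      nlinarith
  have r : - ∫ x, regInvSq ε x * (2 * (conj (f x) * xDot g x).re) ≤
      ∫ x, (1 / 2 * (regInvSq ε x * ‖f x‖ ^ 2) + 2 * ‖g x‖ ^ 2) := by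
    rw [← integral_neg]
    refine integral_mono (hf.integrable_regInvSq_mul hε).neg
      ((hu.const_mul _).add ((integrable_sq_norm hf.memLp_grad).const_mul 2)) fun x => ?_
    have h1 : -(conj (f x) * xDot g x).re ≤ ‖f x‖ * (‖x‖ * ‖g x‖) := by
      refine (neg_le_abs _).trans ((Complex.abs_re_le_norm _).trans ?_)
      rw [norm_mul, RCLike.norm_conj]
      exact mul_le_mul_of_nonneg_left (norm_xDot_le g x) (norm_nonneg _)
    have h2 := regInvSq_pos hε x
    have h3 := norm_sq_mul_regInvSq_le hε x
    calc -(regInvSq ε x * (2 * (conj (f x) * xDot g x).re))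
        = 2 * regInvSq ε x * (-(conj (f x) * xDot g x).re) := by ring
      _ ≤ 2 * regInvSq ε x * (‖f x‖ * (‖x‖ * ‖g x‖)) := by gcongr
      _ ≤ 1 / 2 * (‖x‖ ^ 2 * regInvSq ε x * (regInvSq ε x * ‖f x‖ ^ 2)) + 2 * ‖g x‖ ^ 2 := by
        nlinarith [sq_nonneg (regInvSq ε x * ‖f x‖ * ‖x‖ - 2 * ‖g x‖)]
      _ ≤ 1 / 2 * (1 * (regInvSq ε x * ‖f x‖ ^ 2)) + 2 * ‖g x‖ ^ 2 := by gcongr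
      _ = _ := by ring
  rw [integral_add (hu.const_mul _) ((integrable_sq_norm hf.memLp_grad).const_mul 2),
    integral_const_mul, integral_const_mul] at r
  linarith

theorem ae_ne_zero {n : ℕ} (hn : 3 ≤ n) : ∀ᵐ x : Rn n, x ≠ 0 := by
  have : Nonempty (Fin n) := ⟨⟨0, by omega⟩⟩
  exact Measure.ae_ne volume 0

theorem norm_divAbs_sq {n : ℕ} (f : Rn n → ℂ) (x : Rn n) :
    ‖divAbs f x‖ ^ 2 = (‖x‖ ^ 2)⁻¹ * ‖f x‖ ^ 2 := by
  simp [divAbs, div_eq_inv_mul, mul_pow]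

theorem aestronglyMeasurable_divAbs {n : ℕ} {f : Rn n → ℂ}
    (hf : AEStronglyMeasurable f volume) : AEStronglyMeasurable (divAbs f) volume := by
  have : AEStronglyMeasurable (fun x : Rn n => ((‖x‖ : ℝ) : ℂ)) volume :=
    (Complex.continuous_ofReal.comp continuous_norm).aestronglyMeasurable
  exact hf.div₀ this

theorem InH1.memLp_divAbs {n : ℕ} (hn : 3 ≤ n) {f : Rn n → ℂ} {g : Rn n → Cn n}
    (hf : InH1 f g) : MemLp (divAbs f) 2 volume := by
  have hm := aestronglyMeasurable_divAbs hf.memLp.aestronglyMeasurable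
  rw [memLp_two_iff_integrable_sq_norm hm]
  let F : ℕ → Rn n → ℝ := fun k x => regInvSq (1 / ((k : ℝ) + 1)) x * ‖f x‖ ^ 2
  have hε : ∀ k : ℕ, (0 : ℝ) < 1 / ((k : ℝ) + 1) := fun k => by positivity
  have hF : ∀ k, Integrable (F k) := fun k => hf.integrable_regInvSq_mul_norm_sq (hε k)
  have hF0 : ∀ k x, 0 ≤ F k x := fun k x => mul_nonneg (regInvSq_pos (hε k) x).le (by positivity)
  -- Fatou's lemma along `ε = 1/(k+1)`, with the uniform bound controlling the liminf.
  refine memLp_one_iff_integrable.1 ⟨by fun_prop, ?_⟩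
  refine (Lp.eLpNorm_lim_le_liminf_eLpNorm (f := F) (fun k => (hF k).aestronglyMeasurable) _
    ?_).trans_lt ?_
  · filter_upwards [ae_ne_zero hn] with x hx
    rw [norm_divAbs_sq]
    exact (tendsto_regInvSq hx).mul_const _
  · refine lt_of_le_of_lt (b := ENNReal.ofReal (4 * ∫ x, ‖g x‖ ^ 2)) ?_ ENNReal.ofReal_lt_top
    refine liminf_le_of_le (by isBoundedDefault) fun b hb => ?_
    obtain ⟨k, hk⟩ := hb.exists
    refine hk.trans ?_
    rw [eLpNorm_one_eq_lintegral_enorm, ← ofReal_integral_norm_eq_lintegral_enorm (hF k)]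
    refine ENNReal.ofReal_le_ofReal ?_
    simp only [Real.norm_of_nonneg (hF0 k _)]
    exact hf.integral_regInvSq_mul_norm_sq_le hn (hε k)

/-! ### The radial derivative and the Hardy equality -/

theorem radialDot_eq {n : ℕ} (g : Rn n → Cn n) (x : Rn n) :
    radialDot g x = ((‖x‖⁻¹ : ℝ) : ℂ) * xDot g x := by
  simp only [radialDot, xDot, Finset.mul_sum]
  refine Finset.sum_congr rfl fun j _ => ?_
  push_cast
  ring

theorem norm_radialDot_le {n : ℕ} (g : Rn n → Cn n) (x : Rn n) : ‖radialDot g x‖ ≤ ‖g x‖ := by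
  rw [radialDot_eq, norm_mul, Complex.norm_real, norm_inv, norm_norm]
  calc _ ≤ ‖x‖⁻¹ * (‖x‖ * ‖g x‖) := by gcongr; exact norm_xDot_le g x
    _ = (‖x‖⁻¹ * ‖x‖) * ‖g x‖ := by ring
    _ ≤ 1 * ‖g x‖ := by gcongr; exact inv_mul_le_one
    _ = _ := one_mul _

theorem memLp_radialDot {n : ℕ} {g : Rn n → Cn n} (hg : MemLp g 2 volume) :
    MemLp (radialDot g) 2 volume := by
  refine hg.mono ?_ (ae_of_all _ (norm_radialDot_le g))
  have h1 : AEStronglyMeasurable (fun x : Rn n => ((‖x‖⁻¹ : ℝ) : ℂ)) volume :=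
    (Complex.measurable_ofReal.comp measurable_norm.inv).aestronglyMeasurable
  exact (h1.mul (aestronglyMeasurable_xDot hg.aestronglyMeasurable)).congr
    (ae_of_all _ fun x => (radialDot_eq g x).symm)

/-- The radial integration by parts behind Hardy's inequality. -/
theorem InH1.integral_conj_divAbs_mul_radialDot {n : ℕ} (hn : 3 ≤ n) {f : Rn n → ℂ}
    {g : Rn n → Cn n} (hf : InH1 f g) :
    ∫ x, 2 * (conj (divAbs f x) * radialDot g x).re = -(((n : ℝ) - 2) * l2 (divAbs f) ^ 2) := by
  have hd := hf.memLp_divAbs hn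
  have hr := memLp_radialDot hf.memLp_grad
  have hε : ∀ k : ℕ, (0 : ℝ) < 1 / ((k : ℝ) + 1) := fun k => by positivity
  have hP : ∀ x, 2 * (conj (divAbs f x) * radialDot g x).re =
      (‖x‖ ^ 2)⁻¹ * (2 * (conj (f x) * xDot g x).re) := by
    intro x
    have : conj (divAbs f x) * radialDot g x =
        (((‖x‖ ^ 2)⁻¹ : ℝ) : ℂ) * (conj (f x) * xDot g x) := by
      rw [radialDot_eq, divAbs, map_div₀, Complex.conj_ofReal]
      push_cast
      ring
    rw [this, Complex.re_ofReal_mul]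
    ring
  have hi := integrable_two_mul_re_conj_mul hr hd
  -- The limit itself is an integrable majorant, because `regInvSq` increases to `|x|⁻²` and `ψ/|x|`
  -- is already known to be in `L²`.
  have l1 : Tendsto (fun k : ℕ => ∫ x, regInvSq (1 / ((k : ℝ) + 1)) x *
      (2 * (conj (f x) * xDot g x).re)) atTop
      (𝓝 (∫ x, 2 * (conj (divAbs f x) * radialDot g x).re)) := by
    refine tendsto_integral_of_dominated_convergence _
      (fun k => (hf.integrable_regInvSq_mul (hε k)).aestronglyMeasurable) hi.norm ?_ ?_
    · intro k
      filter_upwards [ae_ne_zero hn] with x hx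
      rw [hP, norm_mul, norm_mul (‖x‖ ^ 2)⁻¹, Real.norm_of_nonneg (regInvSq_pos (hε k) x).le,
        Real.norm_of_nonneg (by positivity : 0 ≤ (‖x‖ ^ 2)⁻¹)]
      exact mul_le_mul_of_nonneg_right (regInvSq_le (hε k) hx) (norm_nonneg _)
    · filter_upwards [ae_ne_zero hn] with x hx
      rw [hP]
      exact (tendsto_regInvSq hx).mul_const _
  -- Pointwise, `n r - 2|x|² r²` tends to `(n-2)|x|⁻²` as `r → |x|⁻²`.
  have l2' : Tendsto (fun k : ℕ => ∫ x, (n * regInvSq (1 / ((k : ℝ) + 1)) x -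
      2 * ‖x‖ ^ 2 * regInvSq (1 / ((k : ℝ) + 1)) x ^ 2) * ‖f x‖ ^ 2) atTop
      (𝓝 (∫ x, ((n : ℝ) - 2) * ‖divAbs f x‖ ^ 2)) := by
    refine tendsto_integral_of_dominated_convergence (fun x => (n + 2) * ‖divAbs f x‖ ^ 2)
      ?_ ((integrable_sq_norm hd).const_mul _) ?_ ?_
    · intro k
      refine Continuous.aestronglyMeasurable ?_ |>.mul
          (integrable_sq_norm hf.memLp).aestronglyMeasurable
      have := (contDiff_regInvSq (n := n) (hε k)).continuous
      fun_prop
    · intro k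
      filter_upwards [ae_ne_zero hn] with x hx
      have h1 := norm_sq_mul_regInvSq_le (hε k) x
      have h2 := regInvSq_pos (hε k) x
      have h3 := regInvSq_le (hε k) hx
      have h4 : 0 ≤ ‖x‖ ^ 2 * regInvSq (1 / ((k : ℝ) + 1)) x := by positivity
      rw [norm_divAbs_sq, norm_mul, norm_pow, norm_norm, ← mul_assoc]
      refine mul_le_mul_of_nonneg_right ?_ (by positivity)
      refine le_trans ?_ (mul_le_mul_of_nonneg_left h3 (by positivity))
      rw [Real.norm_eq_abs, abs_le]
      have hn0 : (0 : ℝ) ≤ n := Nat.cast_nonneg n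
      constructor <;> nlinarith
    · filter_upwards [ae_ne_zero hn] with x hx
      have h0 : ‖x‖ ≠ 0 := by simpa using hx
      have t := tendsto_regInvSq hx
      have := ((t.const_mul (n : ℝ)).sub ((t.pow 2).const_mul (2 * ‖x‖ ^ 2))).mul_const
        (‖f x‖ ^ 2)
      convert this using 2
      rw [norm_divAbs_sq]
      field_simp
  have := tendsto_nhds_unique (l2'.congr fun k => hf.integral_regInvSq (hε k)) l1.neg
  rw [integral_const_mul, ← l2_sq hd] at this
  linarith

theorem hardyRemainder_eq {n : ℕ} (f : Rn n → ℂ) (g : Rn n → Cn n) :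
    hardyRemainder f g = fun x => radialDot g x + ((((n : ℝ) - 2) / 2 : ℝ) : ℂ) * divAbs f x := by
  ext x
  simp only [hardyRemainder, divAbs]
  push_cast
  ring

/-- With `c = (n-2)/2` the cross term contributes `-2c²`, which leaves `-c²` after adding the
square. -/
theorem InH1.hardyEquality {n : ℕ} (hn : 3 ≤ n) {f : Rn n → ℂ} {g : Rn n → Cn n}
    (hf : InH1 f g) : HardyEquality f g := by
  rw [HardyEquality, hardyRemainder_eq, l2_sq_add_const_mul (memLp_radialDot hf.memLp_grad)
    (hf.memLp_divAbs hn), hf.integral_conj_divAbs_mul_radialDot hn]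
  ring

theorem hardyEqualityHolds {n : ℕ} (hn : 3 ≤ n) : HardyEqualityHolds n :=
  fun _ _ h => ⟨h.memLp_divAbs hn, h.hardyEquality hn⟩

theorem InH1.hardy_inequality {n : ℕ} (hn : 3 ≤ n) {f : Rn n → ℂ} {g : Rn n → Cn n}
    (hf : InH1 f g) : l2 (divAbs f) ≤ 2 / ((n : ℝ) - 2) * l2 (radialDot g) := by
  have hn' : (3 : ℝ) ≤ n := by exact_mod_cast hn
  have h := hf.hardyEquality hn
  rw [HardyEquality] at h
  have h1 : ((n : ℝ) - 2) / 2 * l2 (divAbs f) ≤ l2 (radialDot g) := by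
    refine le_of_sq_le_sq ?_ lpNorm_nonneg
    rw [mul_pow, h]
    linarith [sq_nonneg (l2 (hardyRemainder f g))]
  rw [div_mul_eq_mul_div, le_div_iff₀ (by linarith)]
  linarith

theorem l2_radialDot_le {n : ℕ} {g : Rn n → Cn n} (hg : MemLp g 2 volume) :
    l2 (radialDot g) ≤ l2 g := by
  refine le_of_sq_le_sq ?_ lpNorm_nonneg
  rw [l2_sq hg, l2_sq (memLp_radialDot hg)]
  refine integral_mono (integrable_sq_norm (memLp_radialDot hg)) (integrable_sq_norm hg) fun x => ?_
  exact pow_le_pow_left₀ (norm_nonneg _) (norm_radialDot_le g x) 2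

/-! ### The weak gradient of `ψ/|x|` -/

/-- In polar coordinates the radial integrand is `r^(n-1) r⁻² = r^(n-3)`, continuous down to `0`
exactly because `n ≥ 3`. -/
theorem locallyIntegrable_inv_norm_sq {n : ℕ} (hn : 3 ≤ n) :
    LocallyIntegrable (fun x : Rn n => (‖x‖ ^ 2)⁻¹) volume := by
  have : Nonempty (Fin n) := ⟨⟨0, by omega⟩⟩
  rw [locallyIntegrable_iff]
  intro K hK
  obtain ⟨R, hR⟩ := hK.isBounded.subset_closedBall 0
  refine IntegrableOn.mono_set ?_ hR
  have h := (integrable_fun_norm_addHaar (volume : Measure (Rn n))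
    (f := (Set.Iic R).indicator fun r : ℝ => (r ^ 2)⁻¹)).2 ?_
  · rw [← integrable_indicator_iff measurableSet_closedBall]
    refine h.congr (ae_of_all _ fun x => ?_)
    beta_reduce
    by_cases hx : ‖x‖ ≤ R
    · rw [Set.indicator_of_mem (Set.mem_Iic.2 hx),
        Set.indicator_of_mem (mem_closedBall_zero_iff.2 hx)]
    · rw [Set.indicator_of_notMem (mt Set.mem_Iic.1 hx),
        Set.indicator_of_notMem (mt mem_closedBall_zero_iff.1 hx)]
  · have hc : IntegrableOn (fun r : ℝ => r ^ (n - 3)) (Set.Ioc 0 R) volume :=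
      ((continuous_pow (n - 3)).integrableOn_Icc (a := 0) (b := R)).mono_set Set.Ioc_subset_Icc_self
    have hc' : IntegrableOn ((Set.Iic R).indicator fun r : ℝ => r ^ (n - 3)) (Set.Ioi 0) volume := by
      rw [IntegrableOn, integrable_indicator_iff measurableSet_Iic, IntegrableOn,
        Measure.restrict_restrict measurableSet_Iic, Set.inter_comm, Set.Ioi_inter_Iic]
      exact hc
    refine hc'.congr_fun (fun r hr => ?_) measurableSet_Ioi
    have hr' : r ≠ 0 := (Set.mem_Ioi.1 hr).ne'
    simp only [Set.indicator_apply, finrank_euclideanSpace, Fintype.card_fin, smul_eq_mul]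
    split_ifs
    · rw [show n - 1 = (n - 3) + 2 by omega, pow_add]
      field_simp
    · simp

theorem locallyIntegrable_inv_norm_mul {n : ℕ} (hn : 3 ≤ n) {u : Rn n → ℝ}
    (hu : MemLp u 2 volume) : LocallyIntegrable (fun x => ‖x‖⁻¹ * u x) volume := by
  refine ((locallyIntegrable_inv_norm_sq hn).add
    (hu.integrable_sq.locallyIntegrable)).mono ?_ (ae_of_all _ fun x => ?_)
  · exact (measurable_norm.inv.aestronglyMeasurable).mul hu.aestronglyMeasurable
  · simp only [norm_mul, norm_inv, norm_norm, Pi.add_apply, ← inv_pow]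
    rw [Real.norm_of_nonneg (by positivity : 0 ≤ ‖x‖⁻¹ ^ 2 + u x ^ 2), Real.norm_eq_abs,
      ← sq_abs (u x)]
    nlinarith [sq_nonneg (‖x‖⁻¹ - |u x|), sq_nonneg (‖x‖⁻¹), sq_nonneg (|u x|)]

/-- The regularization `(|x|² + ε)^(-1/2)` of `|x|⁻¹`. -/
noncomputable def regInv {n : ℕ} (ε : ℝ) (x : Rn n) : ℝ := (√(‖x‖ ^ 2 + ε))⁻¹

section regInv

variable {n : ℕ} {ε : ℝ}

theorem contDiff_regInv (hε : 0 < ε) : ContDiff ℝ ∞ (regInv (n := n) ε) :=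
  (((contDiff_norm_sq ℝ).add contDiff_const).sqrt fun x => by positivity).inv
    fun x => by positivity

theorem fderiv_regInv (hε : 0 < ε) (x v : Rn n) :
    fderiv ℝ (regInv ε) x v = -(inner ℝ x v * regInv ε x ^ 3) := by
  have h0 : ‖x‖ ^ 2 + ε ≠ 0 := by positivity
  have h1 : √(‖x‖ ^ 2 + ε) ≠ 0 := by positivity
  have e := ((hasDerivAt_inv h1).comp _ (Real.hasDerivAt_sqrt h0)).comp_hasFDerivAt x
    ((hasStrictFDerivAt_norm_sq x).hasFDerivAt.add_const ε)
  have : regInv ε = (Inv.inv ∘ Real.sqrt) ∘ fun y : Rn n => ‖y‖ ^ 2 + ε := rfl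
  rw [this, e.fderiv]
  simp
  field_simp

theorem regInv_pos (hε : 0 < ε) (x : Rn n) : 0 < regInv ε x := by
  unfold regInv; positivity

theorem regInv_le (hε : 0 < ε) {x : Rn n} (hx : x ≠ 0) : regInv ε x ≤ ‖x‖⁻¹ := by
  unfold regInv
  have := norm_pos_iff.2 hx
  exact inv_anti₀ this (Real.le_sqrt_of_sq_le (by linarith))

theorem tendsto_regInv {x : Rn n} (hx : x ≠ 0) :
    Tendsto (fun k : ℕ => regInv (1 / ((k : ℝ) + 1)) x) atTop (𝓝 ‖x‖⁻¹) := by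
  unfold regInv
  have h := ((tendsto_one_div_add_atTop_nhds_zero_nat (𝕜 := ℝ)).const_add (‖x‖ ^ 2)).sqrt
  rw [add_zero, Real.sqrt_sq (norm_nonneg x)] at h
  exact h.inv₀ (by simpa using hx)

end regInv

/-- The inclusion `ℝⁿ → ℂⁿ`. -/
noncomputable def toCn {n : ℕ} (x : Rn n) : Cn n := WithLp.toLp 2 fun j => ((x j : ℝ) : ℂ)

theorem norm_toCn {n : ℕ} (x : Rn n) : ‖toCn x‖ = ‖x‖ := by
  simp [toCn, EuclideanSpace.norm_eq]

theorem continuous_toCn {n : ℕ} : Continuous (toCn (n := n)) := by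
  unfold toCn
  fun_prop

/-- The gradient `∇ψ/|x| - ψ x/|x|³` of `ψ/|x|`, where `g = ∇ψ`. -/
noncomputable def gradDivAbs {n : ℕ} (ψ : Rn n → ℂ) (g : Rn n → Cn n) (x : Rn n) : Cn n :=
  (‖x‖⁻¹ : ℝ) • g x - (((‖x‖⁻¹ ^ 2 : ℝ) : ℂ) * divAbs ψ x) • toCn x

theorem gradDivAbs_apply {n : ℕ} (ψ : Rn n → ℂ) (g : Rn n → Cn n) (x : Rn n) (j : Fin n) :
    gradDivAbs ψ g x j = ((‖x‖⁻¹ : ℝ) : ℂ) * g x j -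
      ((‖x‖⁻¹ ^ 2 : ℝ) : ℂ) * divAbs ψ x * ((x j : ℝ) : ℂ) := by
  simp [gradDivAbs, toCn]

theorem xDot_gradDivAbs {n : ℕ} (ψ : Rn n → ℂ) (g : Rn n → Cn n) {x : Rn n} (hx : x ≠ 0) :
    xDot (gradDivAbs ψ g) x = radialDot g x + ((-1 : ℝ) : ℂ) * divAbs ψ x := by
  have h0 : (‖x‖ : ℂ) ≠ 0 := by simpa using hx
  have hx2 : ∑ j, ((x j : ℝ) : ℂ) * ((x j : ℝ) : ℂ) = (‖x‖ : ℂ) ^ 2 := by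
    have := EuclideanSpace.real_norm_sq_eq x
    exact_mod_cast (by rw [this]; simp only [pow_two] :
      ∑ j, x j * x j = ‖x‖ ^ 2)
  have : xDot (gradDivAbs ψ g) x = ((‖x‖⁻¹ : ℝ) : ℂ) * xDot g x -
      ((‖x‖⁻¹ ^ 2 : ℝ) : ℂ) * divAbs ψ x * ∑ j, ((x j : ℝ) : ℂ) * ((x j : ℝ) : ℂ) := by
    simp only [xDot, gradDivAbs_apply, Finset.mul_sum, ← Finset.sum_sub_distrib]
    refine Finset.sum_congr rfl fun j _ => ?_
    ring
  rw [this, hx2, radialDot_eq]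
  push_cast
  field_simp
  ring

/-- Multiplying a test function by `(|x|² + ε)^(-1/2)` gives a test function for `ψ`; then `ε → 0`.
The singular term is at most `|x|⁻¹ |ψ/|x||`, locally integrable as a product of two locally square
integrable functions, so the origin contributes nothing. -/
theorem InH1.isWeakGradient_divAbs {n : ℕ} (hn : 3 ≤ n) {ψ : Rn n → ℂ} {g : Rn n → Cn n}
    (hψ : InH1 ψ g) : IsWeakGradient (divAbs ψ) (gradDivAbs ψ g) := by
  have hd := hψ.memLp_divAbs hn
  have hε : ∀ k : ℕ, (0 : ℝ) < 1 / ((k : ℝ) + 1) := fun k => by positivity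
  have hm : Measurable fun x : Rn n => ‖x‖⁻¹ := measurable_norm.inv
  have hl1 := locallyIntegrable_inv_norm_mul hn hψ.memLp_grad.norm
  have hl2 := locallyIntegrable_inv_norm_mul hn hd.norm
  have hx1 : ∀ x : Rn n, ‖x‖⁻¹ ^ 2 * ‖x‖ ≤ ‖x‖⁻¹ := fun x => by
    rw [pow_two, mul_assoc]
    exact mul_le_of_le_one_right (by positivity) inv_mul_le_one
  have hmeas : AEStronglyMeasurable (gradDivAbs ψ g) volume := by
    refine (hm.aestronglyMeasurable.smul hψ.memLp_grad.aestronglyMeasurable).sub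
      (AEStronglyMeasurable.smul (f := fun x => ((‖x‖⁻¹ ^ 2 : ℝ) : ℂ) * divAbs ψ x) ?_
        continuous_toCn.aestronglyMeasurable)
    exact (Complex.measurable_ofReal.comp (hm.pow_const 2)).aestronglyMeasurable.mul
      hd.aestronglyMeasurable
  refine ⟨hd.locallyIntegrable (by norm_num), (hl1.add hl2).mono hmeas
    (ae_of_all _ fun x => ?_), ?_⟩
  · rw [Pi.add_apply, Real.norm_of_nonneg (by positivity :
      0 ≤ ‖x‖⁻¹ * ‖g x‖ + ‖x‖⁻¹ * ‖divAbs ψ x‖)]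
    refine (norm_sub_le _ _).trans (add_le_add ?_ ?_)
    · simp [norm_smul]
    · rw [norm_smul, norm_mul, norm_toCn, Complex.norm_real, Real.norm_of_nonneg (by positivity)]
      calc _ = (‖x‖⁻¹ ^ 2 * ‖x‖) * ‖divAbs ψ x‖ := by ring
        _ ≤ _ := by gcongr; exact hx1 x
  intro j θ hθ hθc
  let D : Rn n → ℝ := fun x => fderiv ℝ θ x (EuclideanSpace.single j 1)
  have hDc : Continuous D := (hθ.continuous_fderiv (by simp)).clm_apply continuous_const
  have hDs : HasCompactSupport D := hθc.fderiv_apply ℝ _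
  have hxj : ∀ x : Rn n, |x j| ≤ ‖x‖ := fun x => by
    simpa using PiLp.norm_apply_le x j
  have hψm := hψ.memLp.aestronglyMeasurable
  have hgm := (hψ.memLp_grad.euclidean_apply j).aestronglyMeasurable
  have hcj : Continuous fun x : Rn n => x j := (EuclideanSpace.proj (𝕜 := ℝ) j).continuous
  have iD : Integrable fun x => ‖D x‖ * ‖divAbs ψ x‖ :=
    (hd.norm.locallyIntegrable (by norm_num)).integrable_smul_left_of_hasCompactSupport
      hDc.norm hDs.norm
  have iθ : Integrable fun x => ‖θ x‖ * (‖x‖⁻¹ * ‖divAbs ψ x‖) :=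
    hl2.integrable_smul_left_of_hasCompactSupport hθ.continuous.norm hθc.norm
  have ig : Integrable fun x => ‖θ x‖ * (‖x‖⁻¹ * ‖g x‖) :=
    hl1.integrable_smul_left_of_hasCompactSupport hθ.continuous.norm hθc.norm
  have key : ∀ k : ℕ, ∫ x, (D x * regInv (1 / ((k : ℝ) + 1)) x -
      θ x * (x j * regInv (1 / ((k : ℝ) + 1)) x ^ 3)) • ψ x =
      - ∫ x, (θ x * regInv (1 / ((k : ℝ) + 1)) x) • g x j := by
    intro k
    have hw := contDiff_regInv (n := n) (hε k)
    have h := hψ.isWeakGradient.integral_eq j (fun x => θ x * regInv (1 / ((k : ℝ) + 1)) x)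
      (hθ.mul hw) hθc.mul_right
    rw [← h]
    congr 1
    ext x
    rw [fderiv_fun_mul (hθ.differentiable (by simp) x) (hw.differentiable (by simp) x)]
    simp only [add_apply, smul_apply, smul_eq_mul, fderiv_regInv (hε k)]
    congr 1
    simp [D, EuclideanSpace.inner_single_right]
    ring
  have e3 : ∀ x : Rn n, ((‖x‖⁻¹ : ℝ) : ℂ) * ψ x = divAbs ψ x := fun x => by
    simp [divAbs, div_eq_inv_mul]
  have l1 : Tendsto (fun k : ℕ => ∫ x, (D x * regInv (1 / ((k : ℝ) + 1)) x -
      θ x * (x j * regInv (1 / ((k : ℝ) + 1)) x ^ 3)) • ψ x) atTop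
      (𝓝 (∫ x, (D x * ‖x‖⁻¹ - θ x * (x j * ‖x‖⁻¹ ^ 3)) • ψ x)) := by
    refine tendsto_integral_of_dominated_convergence _ ?_ (iD.add iθ) ?_ ?_
    · intro k
      have hw := (contDiff_regInv (n := n) (hε k)).continuous
      exact ((hDc.mul hw).sub (hθ.continuous.mul
        (hcj.mul (hw.pow 3)))).aestronglyMeasurable.smul hψm
    · intro k
      filter_upwards [ae_ne_zero hn] with x hx
      have h0 := regInv_pos (hε k) x
      have h1 := regInv_le (hε k) hx
      -- One factor `|x|⁻¹` is kept with `ψ`; in the second term `|xⱼ| ≤ |x|` cancels another.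
      have h2 : ‖divAbs ψ x‖ = ‖x‖⁻¹ * ‖ψ x‖ := by simp [← e3]
      rw [norm_smul, Pi.add_apply, h2]
      have h3 : ‖x‖ * ‖x‖⁻¹ = 1 := mul_inv_cancel₀ (by simpa using hx)
      have h4 : ‖D x * regInv (1 / ((k : ℝ) + 1)) x -
          θ x * (x j * regInv (1 / ((k : ℝ) + 1)) x ^ 3)‖ ≤
          ‖D x‖ * ‖x‖⁻¹ + ‖θ x‖ * (‖x‖ * ‖x‖⁻¹ ^ 3) := by
        refine (norm_sub_le _ _).trans (add_le_add ?_ ?_)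
        · rw [norm_mul, Real.norm_of_nonneg h0.le]
          gcongr
        · rw [norm_mul, norm_mul, norm_pow, Real.norm_of_nonneg h0.le]
          gcongr
          exact hxj x
      calc _ ≤ (‖D x‖ * ‖x‖⁻¹ + ‖θ x‖ * (‖x‖ * ‖x‖⁻¹ ^ 3)) * ‖ψ x‖ := by gcongr
        _ = ‖D x‖ * (‖x‖⁻¹ * ‖ψ x‖) +
            ‖θ x‖ * ((‖x‖ * ‖x‖⁻¹) * ‖x‖⁻¹ * (‖x‖⁻¹ * ‖ψ x‖)) := by ring
        _ = _ := by rw [h3]; ring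
    · filter_upwards [ae_ne_zero hn] with x hx
      have t := tendsto_regInv hx
      exact ((t.const_mul (D x)).sub (((t.pow 3).const_mul (x j)).const_mul (θ x))).smul_const _
  have l2' : Tendsto (fun k : ℕ => ∫ x, (θ x * regInv (1 / ((k : ℝ) + 1)) x) • g x j) atTop
      (𝓝 (∫ x, (θ x * ‖x‖⁻¹) • g x j)) := by
    refine tendsto_integral_of_dominated_convergence _ ?_ ig ?_ ?_
    · intro k
      have hw := (contDiff_regInv (n := n) (hε k)).continuous
      exact (hθ.continuous.mul hw).aestronglyMeasurable.smul hgm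
    · intro k
      filter_upwards [ae_ne_zero hn] with x hx
      have h0 := regInv_pos (hε k) x
      have h1 := regInv_le (hε k) hx
      rw [norm_smul, norm_mul, Real.norm_of_nonneg h0.le, mul_assoc]
      have := PiLp.norm_apply_le (g x) j
      gcongr
    · filter_upwards [ae_ne_zero hn] with x hx
      exact ((tendsto_regInv hx).const_mul (θ x)).smul_const _
  have lim := tendsto_nhds_unique (l1.congr key) l2'.neg
  have jD : Integrable fun x => D x • divAbs ψ x :=
    (hd.locallyIntegrable (by norm_num)).integrable_smul_left_of_hasCompactSupport hDc hDs
  have jθ : Integrable fun x => θ x • (((‖x‖⁻¹ ^ 2 : ℝ) : ℂ) * divAbs ψ x * ((x j : ℝ) : ℂ)) := by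
    refine iθ.mono' ?_ (ae_of_all _ fun x => ?_)
    · refine hθ.continuous.aestronglyMeasurable.smul (AEStronglyMeasurable.mul ?_
        (Complex.continuous_ofReal.comp hcj).aestronglyMeasurable)
      exact (Complex.measurable_ofReal.comp (hm.pow_const 2)).aestronglyMeasurable.mul
        hd.aestronglyMeasurable
    · rw [norm_smul, norm_mul, norm_mul, Complex.norm_real, Complex.norm_real,
        Real.norm_of_nonneg (by positivity : 0 ≤ ‖x‖⁻¹ ^ 2)]
      refine mul_le_mul_of_nonneg_left ?_ (norm_nonneg _)
      calc _ ≤ ‖x‖⁻¹ ^ 2 * ‖divAbs ψ x‖ * ‖x‖ :=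
            mul_le_mul_of_nonneg_left (hxj x) (by positivity)
        _ = (‖x‖⁻¹ ^ 2 * ‖x‖) * ‖divAbs ψ x‖ := by ring
        _ ≤ _ := by gcongr; exact hx1 x
  have jg : Integrable fun x => (θ x * ‖x‖⁻¹) • g x j := by
    refine ig.mono' ?_ (ae_of_all _ fun x => ?_)
    · exact (hθ.continuous.aestronglyMeasurable.mul hm.aestronglyMeasurable).smul hgm
    · rw [norm_smul, norm_mul, norm_inv, norm_norm, mul_assoc]
      have := PiLp.norm_apply_le (g x) j
      gcongr
  have e1 : ∫ x, (D x * ‖x‖⁻¹ - θ x * (x j * ‖x‖⁻¹ ^ 3)) • ψ x =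
      (∫ x, D x • divAbs ψ x) -
        ∫ x, θ x • (((‖x‖⁻¹ ^ 2 : ℝ) : ℂ) * divAbs ψ x * ((x j : ℝ) : ℂ)) := by
    rw [← integral_sub jD jθ]
    congr 1
    ext x
    simp only [← e3, Complex.real_smul]
    push_cast
    ring
  have e2 : ∫ x, θ x • gradDivAbs ψ g x j = (∫ x, (θ x * ‖x‖⁻¹) • g x j) -
        ∫ x, θ x • (((‖x‖⁻¹ ^ 2 : ℝ) : ℂ) * divAbs ψ x * ((x j : ℝ) : ℂ)) := by
    rw [← integral_sub jg jθ]
    congr 1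
    ext x
    simp only [gradDivAbs_apply, Complex.real_smul]
    push_cast
    ring
  rw [e1] at lim
  rw [e2]
  change ∫ x, D x • divAbs ψ x = _
  linear_combination lim

/-! ### Uniqueness of weak gradients and the correspondence -/

/-- The fundamental lemma of the calculus of variations in each coordinate. It transfers the
explicit formula for `∇(ψ/|x|)` to an arbitrary weak gradient. -/
theorem IsWeakGradient.ae_eq {n : ℕ} {f : Rn n → ℂ} {g h : Rn n → Cn n}
    (hg : IsWeakGradient f g) (hh : IsWeakGradient f h) : g =ᵐ[volume] h := by
  have : ∀ j : Fin n, ∀ᵐ x : Rn n, g x j = h x j := fun j =>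
    ae_eq_of_integral_contDiff_smul_eq (hg.locallyIntegrable_grad.euclidean_apply j)
      (hh.locallyIntegrable_grad.euclidean_apply j) fun θ hθ hθc =>
        neg_injective ((hg.integral_eq j θ hθ hθc).symm.trans (hh.integral_eq j θ hθ hθc))
  filter_upwards [ae_all_iff.2 this] with x hx
  ext j
  exact hx j

theorem InH1.xDot_ae_eq {n : ℕ} (hn : 3 ≤ n) {ψ : Rn n → ℂ} {g h : Rn n → Cn n}
    (hψ : InH1 ψ g) (hh : IsWeakGradient (divAbs ψ) h) :
    xDot h =ᵐ[volume] fun x => radialDot g x + ((-1 : ℝ) : ℂ) * divAbs ψ x := by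
  filter_upwards [hh.ae_eq (hψ.isWeakGradient_divAbs hn), ae_ne_zero hn] with x hx hx0
  rw [← xDot_gradDivAbs ψ g hx0, xDot, hx, xDot]

theorem theorem3p3 (n : ℕ) (hn : 3 ≤ n) :
    -- the two families of equalities are equivalent, and they hold
    (DilationEqualityHolds n ↔ HardyEqualityHolds n) ∧
    DilationEqualityHolds n ∧
    HardyEqualityHolds n ∧
    -- for each `ψ ∈ H¹`, they correspond to each other term by term under `φ = ψ/|x|`
    (∀ (ψ : Rn n → ℂ) (g : Rn n → Cn n), InH1 ψ g →
      MemLp (divAbs ψ) 2 volume ∧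
      (∃ h : Rn n → Cn n, IsWeakGradient (divAbs ψ) h) ∧
      ∀ h : Rn n → Cn n, IsWeakGradient (divAbs ψ) h →
        MemLp (xDot h) 2 volume ∧
        l2 (xDot h) ^ 2 = l2 (radialDot g) ^ 2 + ((n : ℝ) - 1) * l2 (divAbs ψ) ^ 2 ∧
        dilationRemainder (divAbs ψ) h =ᵐ[volume] hardyRemainder ψ g ∧
        (DilationEquality (divAbs ψ) h ↔ HardyEquality ψ g)) ∧
    -- the Hardy inequality
    (∀ (ψ : Rn n → ℂ) (g : Rn n → Cn n), InH1 ψ g →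
      l2 (divAbs ψ) ≤ 2 / ((n : ℝ) - 2) * l2 (radialDot g) ∧
      2 / ((n : ℝ) - 2) * l2 (radialDot g) ≤ 2 / ((n : ℝ) - 2) * l2 g) := by
  have hn' : (3 : ℝ) ≤ n := by exact_mod_cast hn
  refine ⟨iff_of_true (dilationEqualityHolds n) (hardyEqualityHolds hn), dilationEqualityHolds n,
    hardyEqualityHolds hn, fun ψ g hψ => ⟨hψ.memLp_divAbs hn,
      ⟨_, hψ.isWeakGradient_divAbs hn⟩, fun h hh => ?_⟩, fun ψ g hψ => ⟨hψ.hardy_inequality hn, ?_⟩⟩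
  · have hd := hψ.memLp_divAbs hn
    have hr := memLp_radialDot hψ.memLp_grad
    have hX := hψ.xDot_ae_eq hn hh
    -- Here `c = -1`: the cross term gives `n - 2` and the square gives `1`.
    have hsq : l2 (xDot h) ^ 2 = l2 (radialDot g) ^ 2 + ((n : ℝ) - 1) * l2 (divAbs ψ) ^ 2 := by
      rw [l2_congr hX, l2_sq_add_const_mul hr hd, hψ.integral_conj_divAbs_mul_radialDot hn]
      ring
    have hrem : dilationRemainder (divAbs ψ) h =ᵐ[volume] hardyRemainder ψ g := by
      filter_upwards [hX] with x hx
      rw [dilationRemainder, hx, hardyRemainder_eq]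
      push_cast
      ring
    refine ⟨(hr.add (hd.const_mul ((-1 : ℝ) : ℂ))).ae_eq hX.symm, hsq, hrem, ?_⟩
    rw [DilationEquality, HardyEquality, hsq, l2_congr hrem]
    -- Both directions are the identity `(n/2)² - (n-1) = ((n-2)/2)²`.
    constructor <;> intro e <;> linarith
  · exact mul_le_mul_of_nonneg_left (l2_radialDot_le hψ.memLp_grad)
      (div_nonneg zero_le_two (by linarith))
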